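/- **Setting.** Let $d\ge 1$, $d'$ be integers, $\Theta\subseteq\mathbb R$ an open set, and for $\omega\in\Theta$ let $\mathcal T_\omega(\cdot)=\sum_i K_i(\cdot)K_i^\dagger$ (with $\sum_i K_i^\dagger K_i=I$, where the $K_i$ may depend on $\omega$) be a quantum channel from $\mathbb C^{d\times d}$ to $\mathbb C^{d'\times d'}$. Let $U_1,\dots,U_n\in\mathbb C^{d\times d}$ be unitaries and $p_1,\dots,p_n$ a probability distribution such that $\{(p_i,U_i)\}$ is a unitary 1-design, i.e. $\sum_i p_iU_iAU_i^\dagger=\mathrm{Tr}(A)\,I/d$ for all $A\in\mathbb C^{d\times d}$. Assume that $\mathcal T_\omega$ is jointly covariant: for every $U\in\{U_1,\dots,U_n\}$ there is a unitary $V$, independent of $\omega$, such that $\mathcal T_\omega(U\rho U^\dagger)=V\mathcal T_\omega(\rho)V^\dagger$ for all $\omega\in\Theta$ and all $\rho$. For a family of density operators $\rho_\omega$, the quantum Fisher information at $\omega$ is $F(\rho_\omega)=\mathrm{Tr}(L^2\rho_\omega)$, where $L$ is any Hermitian solution of $\partial_\omega\rho_\omega=\tfrac12(\rho_\omega L+L\rho_\omega)$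 (the value does not depend on the choice of $L$; put $F=\infty$ if there is none). For a family of channels $\mathcal E_\omega$ let $$\mathfrak F_1(\mathcal E_\omega)=\sup_\rho F\big((\mathcal E_\omega\otimes\mathbb 1)(\rho)\big),\qquad \mathfrak F_N(\mathcal E_\omega)=\mathfrak F_1(\mathcal E_\omega^{\otimes N}),\qquad \mathfrak F_{\rm SQL}(\mathcal E_\omega)=\lim_{N\to\infty}\mathfrak F_N(\mathcal E_\omega)/N,$$ where $\rho$ runs over all density operators (independent of $\omega$) of the input system together with an ancilla of arbitrary finite dimension. A state $\rho$ attaining the supremum in $\mathfrak F_1(\mathcal E_\omega)$ is called an optimal input for $\mathcal E_\omega$. **Claim.** Let $\omega\in\Theta$ be a point at which $\omega\mapsto\mathcal T_\omega$ is differentiable. Then $\mathfrak F_1(\mathcal T_\omega)<\infty$. The maximally entangled state $d^{-1/2}\sum_i|i\rangle|i\rangle$ is an optimal input for $\mathcal T_\omega$, and for every $N$ the maximally entangled state of $(\mathbb C^d)^{\otimes N}$ with an ancilla of the same dimension is an optimal input for $\mathcal T_\omega^{\otimes N}$. Consequently, for every $N$, $$\mathfrak F_N(\mathcal T_\omega)=N\,\mathfrak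 F_1(\mathcal T_\omega),$$ and the limit defining $\mathfrak F_{\rm SQL}(\mathcal T_\omega)$ exists and equals $\mathfrak F_1(\mathcal T_\omega)$. -/

import Mathlib

open Filter Topology
open scoped ENNReal ComplexOrder Matrix

namespace ChannelQFI

/-- A density operator: positive semidefinite with unit trace. -/
def IsDensity {n : Type*} [Fintype n] (ρ : Matrix n n ℂ) : Prop :=
  ρ.PosSemidef ∧ ρ.trace = 1

/-- `L` is a symmetric logarithmic derivative for the pair `(ρ, ρ')`:
a Hermitian solution of `ρ' = (ρ L + L ρ) / 2`. -/
def IsSLD {n : Type*} [Fintype n] (ρ ρ' L : Matrix n n ℂ) : Prop :=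
  L.IsHermitian ∧ ρ' = (1 / 2 : ℂ) • (ρ * L + L * ρ)

/-- The value `Tr (L² ρ)` does not depend on the choice of the symmetric logarithmic
derivative. -/
theorem IsSLD.trace_eq {n : Type*} [Fintype n] {ρ ρ' L M : Matrix n n ℂ}
    (hL : IsSLD ρ ρ' L) (hM : IsSLD ρ ρ' M) :
    (L * L * ρ).trace = (M * M * ρ).trace := by
  have key : ∀ A B : Matrix n n ℂ,
      (A * ((1 / 2 : ℂ) • (ρ * B + B * ρ))).trace
        = (1 / 2 : ℂ) * ((A * ρ * B).trace + (A * B * ρ).trace) := by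
    intro A B
    simp [Matrix.trace_add, Matrix.mul_assoc, mul_add]
  have cyc : ∀ A B : Matrix n n ℂ, (A * ρ * B).trace = (B * A * ρ).trace := by
    intro A B
    rw [Matrix.trace_mul_comm, Matrix.mul_assoc]
  have h1 : (L * L * ρ).trace = (L * ρ').trace := by
    rw [hL.2, key, cyc]; ring
  have h2 : (M * M * ρ).trace = (M * ρ').trace := by
    rw [hM.2, key, cyc]; ring
  have h3 : (L * ρ').trace = (M * ρ').trace := by
    conv_lhs => rw [hM.2]
    conv_rhs => rw [hL.2]
    rw [key, key, cyc, cyc]; ring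
  rw [h1, h2, h3]

/-- Entrywise derivative at `ω` of a matrix depending on a real parameter. -/
noncomputable def matDeriv {n : Type*} (ρ : ℝ → Matrix n n ℂ) (ω : ℝ) : Matrix n n ℂ :=
  Matrix.of fun i j => deriv (fun t => ρ t i j) ω

/-- The quantum Fisher information `F(ρ_ω) = Tr (L² ρ_ω)`, where `L` is a symmetric logarithmic
derivative of the family at `ω`. All such `L` give the same value (`IsSLD.trace_eq`), so the
infimum only selects it; it is `∞` when there is no symmetric logarithmic derivative. -/
noncomputable def qfi {n : Type*} [Fintype n] (ρ : ℝ → Matrix n n ℂ) (ω : ℝ) : ℝ≥0∞ :=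
  ⨅ (L : Matrix n n ℂ) (_ : IsSLD (ρ ω) (matDeriv ρ ω) L),
    ENNReal.ofReal (L * L * ρ ω).trace.re

/-- A quantum channel (input index set `n`, output index set `n'`):
`E(ρ) = ∑ Kᵢ ρ Kᵢ†` with `∑ Kᵢ† Kᵢ = 1`. -/
def IsQuantumChannel {n n' : Type*} [Fintype n] [DecidableEq n] [Fintype n']
    (E : Matrix n n ℂ →ₗ[ℂ] Matrix n' n' ℂ) : Prop :=
  ∃ (r : ℕ) (K : Fin r → Matrix n' n ℂ),
    ∑ i, (K i)ᴴ * K i = 1 ∧ ∀ ρ, E ρ = ∑ i, K i * ρ * (K i)ᴴ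

/-- The map `E ⊗ 𝟙` acting on the probe system together with an ancilla with index set `a`:
`E` is applied to each block `(ρ_{(i,s),(j,t)})_{i,j}`. -/
def withAncilla {n n' : Type*} (a : Type*)
    (E : Matrix n n ℂ →ₗ[ℂ] Matrix n' n' ℂ) (ρ : Matrix (n × a) (n × a) ℂ) :
    Matrix (n' × a) (n' × a) ℂ :=
  Matrix.of fun x y => E (Matrix.of fun i j => ρ (i, x.2) (j, y.2)) x.1 y.1

/-- The `N`-fold tensor power `E^{⊗N}`, acting on matrices indexed by `Fin N → n`. It is the
linear map with `E^{⊗N}(A₁ ⊗ ⋯ ⊗ A_N) = E(A₁) ⊗ ⋯ ⊗ E(A_N)`, see `tensorPower_prod`. -/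
def tensorPower {n n' : Type*} [Fintype n] [DecidableEq n] (N : ℕ)
    (E : Matrix n n ℂ →ₗ[ℂ] Matrix n' n' ℂ) :
    Matrix (Fin N → n) (Fin N → n) ℂ →ₗ[ℂ] Matrix (Fin N → n') (Fin N → n') ℂ where
  toFun A := Matrix.of fun x y => ∑ x' : Fin N → n, ∑ y' : Fin N → n,
    A x' y' * ∏ k, E (Matrix.single (x' k) (y' k) 1) (x k) (y k)
  map_add' A B := by
    ext x y
    simp [add_mul, Finset.sum_add_distrib]
  map_smul' c A := by
    ext x y
    simp [Finset.mul_sum, mul_assoc]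

theorem tensorPower_prod {n n' : Type*} [Fintype n] [DecidableEq n] (N : ℕ)
    (E : Matrix n n ℂ →ₗ[ℂ] Matrix n' n' ℂ) (A : Fin N → Matrix n n ℂ) :
    tensorPower N E (Matrix.of fun x y => ∏ k, A k (x k) (y k))
      = Matrix.of fun x y => ∏ k, E (A k) (x k) (y k) := by
  have hE : ∀ (B : Matrix n n ℂ) (i j : n'),
      E B i j = ∑ s, ∑ t, B s t * E (Matrix.single s t 1) i j := by
    intro B i j
    conv_lhs => rw [Matrix.matrix_eq_sum_single B]
    simp only [map_sum, Matrix.sum_apply]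
    refine Finset.sum_congr rfl fun s _ => Finset.sum_congr rfl fun t _ => ?_
    have : Matrix.single s t (B s t) = B s t • Matrix.single s t (1 : ℂ) := by simp
    rw [this, map_smul]; simp
  ext x y
  simp only [tensorPower, LinearMap.coe_mk, AddHom.coe_mk, Matrix.of_apply]
  simp_rw [fun k => hE (A k) (x k) (y k)]
  rw [Fintype.prod_sum]
  refine Finset.sum_congr rfl fun x' _ => ?_
  rw [Fintype.prod_sum]
  refine Finset.sum_congr rfl fun y' _ => ?_
  rw [Finset.prod_mul_distrib]

/-- The entanglement-assisted channel quantum Fisher information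
`𝔉₁(E_ω) = sup_ρ F((E_ω ⊗ 𝟙)(ρ))`, over all density operators `ρ` (independent of `ω`) on the
probe together with an ancilla of arbitrary finite dimension. -/
noncomputable def channelQFI {n n' : Type*} [Fintype n] [Fintype n']
    (E : ℝ → Matrix n n ℂ →ₗ[ℂ] Matrix n' n' ℂ) (ω : ℝ) : ℝ≥0∞ :=
  ⨆ (m : ℕ) (ρ : Matrix (n × Fin m) (n × Fin m) ℂ) (_ : IsDensity ρ),
    qfi (fun t => withAncilla (Fin m) (E t) ρ) ω

/-- `𝔉_N(E_ω) = 𝔉₁(E_ω^{⊗N})`. -/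
noncomputable def channelQFIPow {n n' : Type*} [Fintype n] [DecidableEq n] [Fintype n']
    (E : ℝ → Matrix n n ℂ →ₗ[ℂ] Matrix n' n' ℂ) (N : ℕ) (ω : ℝ) : ℝ≥0∞ :=
  channelQFI (fun t => tensorPower N (E t)) ω

/-- A density operator on probe and ancilla is an optimal input for `E_ω` if it attains
`𝔉₁(E_ω)`. -/
def IsOptimalInput {n n' a : Type*} [Fintype n] [Fintype n'] [Fintype a]
    (E : ℝ → Matrix n n ℂ →ₗ[ℂ] Matrix n' n' ℂ) (ω : ℝ)
    (ρ : Matrix (n × a) (n × a) ℂ) : Prop :=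
  IsDensity ρ ∧ qfi (fun t => withAncilla a (E t) ρ) ω = channelQFI E ω

/-- The maximally entangled state `|Φ⟩⟨Φ|`, `|Φ⟩ = D^{-1/2} ∑ᵢ |i⟩|i⟩`, where `D` is the
dimension of the probe system. -/
noncomputable def maxEntangled (n : Type*) [Fintype n] [DecidableEq n] :
    Matrix (n × n) (n × n) ℂ :=
  Matrix.of fun x y => if x.1 = x.2 ∧ y.1 = y.2 then (Fintype.card n : ℂ)⁻¹ else 0

/-- `{(pᵢ, Uᵢ)}` is a unitary 1-design on `ℂ^d`. -/
def IsUnitaryOneDesign {d n : ℕ} (p : Fin n → ℝ) (U : Fin n → Matrix (Fin d) (Fin d) ℂ) :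
    Prop :=
  (∀ i, 0 ≤ p i) ∧ ∑ i, p i = 1 ∧ (∀ i, U i ∈ Matrix.unitaryGroup (Fin d) ℂ) ∧
    ∀ A : Matrix (Fin d) (Fin d) ℂ,
      ∑ i, (p i : ℂ) • (U i * A * (U i)ᴴ) = (A.trace / (d : ℂ)) • 1

/-- Joint covariance of the family `T_ω`, `ω ∈ Θ`, with respect to the set `𝕌`: for each
`U ∈ 𝕌` there is a unitary `V`, the same for all `ω ∈ Θ`, with
`T_ω(U ρ U†) = V T_ω(ρ) V†`. -/
def IsJointlyCovariant {d d' : ℕ} (𝕌 : Set (Matrix (Fin d) (Fin d) ℂ)) (Θ : Set ℝ)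
    (T : ℝ → Matrix (Fin d) (Fin d) ℂ →ₗ[ℂ] Matrix (Fin d') (Fin d') ℂ) : Prop :=
  ∀ U ∈ 𝕌, ∃ V ∈ Matrix.unitaryGroup (Fin d') ℂ, ∀ ω ∈ Θ, ∀ ρ,
    T ω (U * ρ * Uᴴ) = V * T ω ρ * Vᴴ

end ChannelQFI

open ChannelQFI

/-!
Let `C_t` be the Choi matrix of `T_t`, `C'` its derivative at `ω`, and `L` a symmetric logarithmic
derivative of `C` at `ω`. It exists because `C_t ≥ 0` near `ω` forces the quadratic form of `C'`
to vanish on the kernel of `C_ω` (`exists_isSLD_matDeriv`).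

Upper bound. A differentiable purification `ρ = W W†`, `ρ' = W' W† + W W'†` bounds the Fisher
information by `4 Tr (W' W'†)` (`qfi_le_of_purification`). The output state for an arbitrary input
`ρ = R R†` is a contraction of `C = B B†` with `ρ`, and `B`, `L B / 2` yield such a purification;
the bound it gives is the pairing of the reduced probe state with `Tr_out (L C L)`. If
`Tr_out (L C L) = c 𝟙`, the bound is `c` for every input (`qfi_withAncilla_le`), and the maximally
entangled input, whose output is `C / d`, attains it (`isOptimalInput_maxEntangled`).

Covariance. Joint covariance makes `V ⊗ Ū` a symmetry of `C_t` for all `t`, hence of `C'`.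
It is then a symmetry of `L C L` and `L C` (`IsSLD.conj_invariant`), so their partial traces
commute with every `Ūᵢ`, and the 1-design property makes them scalar. Moreover `Tr (L C) = Tr C' = 0`, so
`Tr_out (L C) = 0` (`exists_isSLD_choi_of_isJointlyCovariant`).

Several copies. The Choi matrix of `T^{⊗N}` is `C^{⊗N}`, with symmetric logarithmic derivative
`L_N = ∑ₖ 𝟙 ⊗ ⋯ ⊗ L ⊗ ⋯ ⊗ 𝟙`. The cross terms of `Tr_out (L_N C^{⊗N} L_N)` contain the factor
`Tr_out (L C) = 0`, and the diagonal ones add up to `N c 𝟙` (`traceOut_tensorSum`). The criterion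
above applies to `T^{⊗N}` with constant `N c`.
-/

namespace ChannelQFI

/-! ### Symmetric logarithmic derivatives and quantum Fisher information -/

theorem matDeriv_apply {ι : Type*} (ρ : ℝ → Matrix ι ι ℂ) (ω : ℝ) (i j : ι) :
    matDeriv ρ ω i j = deriv (fun t => ρ t i j) ω := rfl

section SLD

variable {ι κ : Type*} [Fintype ι] [Fintype κ]

theorem IsSLD.qfi_eq {ρ : ℝ → Matrix ι ι ℂ} {ω : ℝ} {L : Matrix ι ι ℂ}
    (hL : IsSLD (ρ ω) (matDeriv ρ ω) L) :
    qfi ρ ω = ENNReal.ofReal (L * L * ρ ω).trace.re := by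
  refine le_antisymm (iInf₂_le L hL) (le_iInf₂ fun M hM => ?_)
  rw [hL.trace_eq hM]

/-- In an eigenbasis of `ρ` with eigenvalues `λᵢ` the equation reads
`ρ'ᵢⱼ = (λᵢ + λⱼ) Lᵢⱼ / 2`, so the only obstruction is the block of `ρ'` on the kernel of `ρ`. -/
theorem exists_isSLD {ρ ρ' : Matrix ι ι ℂ} (hρ : ρ.PosSemidef) (hρ' : ρ'.IsHermitian)
    (hker : ∀ v w, ρ *ᵥ v = 0 → ρ *ᵥ w = 0 → star v ⬝ᵥ (ρ' *ᵥ w) = 0) :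
    ∃ L, IsSLD ρ ρ' L := by
  classical
  have hH := hρ.isHermitian
  set U : Matrix ι ι ℂ := (hH.eigenvectorUnitary : Matrix ι ι ℂ) with hU
  set l : ι → ℝ := hH.eigenvalues with hl
  have hUU : U * Uᴴ = 1 := Unitary.mul_star_self_of_mem hH.eigenvectorUnitary.2
  have hUU' : Uᴴ * U = 1 := Unitary.star_mul_self_of_mem hH.eigenvectorUnitary.2
  have hspec : ρ = U * Matrix.diagonal (fun i => (l i : ℂ)) * Uᴴ := by
    have := hH.spectral_theorem
    rw [Unitary.conjStarAlgAut_apply] at this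
    exact this
  have hl0 : ∀ i, 0 ≤ l i := hρ.eigenvalues_nonneg
  set M := Uᴴ * ρ' * U with hM
  have hMH : M.IsHermitian := Matrix.isHermitian_conjTranspose_mul_mul U hρ'
  have hM0 : ∀ i j, l i + l j = 0 → M i j = 0 := by
    intro i j hij
    have hi : l i = 0 := by linarith [hl0 i, hl0 j]
    have hj : l j = 0 := by linarith [hl0 i, hl0 j]
    have hk : ∀ k, l k = 0 → ρ *ᵥ (fun a => U a k) = 0 := by
      intro k hk
      have h := hH.mulVec_eigenvectorBasis k
      rw [← hl, hk, zero_smul] at h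
      exact h
    have h := hker _ _ (hk i hi) (hk j hj)
    rw [← h, hM, Matrix.mul_assoc]
    rfl
  set N : Matrix ι ι ℂ := Matrix.of fun i j => 2 * M i j / ((l i : ℂ) + l j) with hN
  have hNH : N.IsHermitian := by
    ext i j
    have := hMH.apply i j
    simp only [hN, Matrix.conjTranspose_apply, Matrix.of_apply, star_div₀, star_mul', star_add,
      this]
    simp [add_comm]
  refine ⟨U * N * Uᴴ, Matrix.isHermitian_mul_mul_conjTranspose U hNH, ?_⟩
  have hD : (1 / 2 : ℂ) • (Matrix.diagonal (fun i => (l i : ℂ)) * N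
      + N * Matrix.diagonal (fun i => (l i : ℂ))) = M := by
    ext i j
    simp only [Matrix.smul_apply, Matrix.add_apply, Matrix.diagonal_mul, Matrix.mul_diagonal,
      hN, Matrix.of_apply, smul_eq_mul]
    by_cases h : l i + l j = 0
    · simp [hM0 i j h]
    · have : (l i : ℂ) + l j ≠ 0 := by exact_mod_cast h
      field_simp
  have e1 : ρ * (U * N * Uᴴ) = U * (Matrix.diagonal (fun i => (l i : ℂ)) * N) * Uᴴ := by
    rw [hspec]
    calc _ = U * Matrix.diagonal (fun i => (l i : ℂ)) * (Uᴴ * U) * N * Uᴴ := by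
          simp only [Matrix.mul_assoc]
      _ = _ := by rw [hUU']; simp only [Matrix.mul_assoc, Matrix.mul_one]
  have e2 : (U * N * Uᴴ) * ρ = U * (N * Matrix.diagonal (fun i => (l i : ℂ))) * Uᴴ := by
    rw [hspec]
    calc _ = U * N * (Uᴴ * U) * Matrix.diagonal (fun i => (l i : ℂ)) * Uᴴ := by
          simp only [Matrix.mul_assoc]
      _ = _ := by rw [hUU']; simp only [Matrix.mul_assoc, Matrix.mul_one]
  rw [e1, e2, ← Matrix.add_mul, ← Matrix.mul_add, ← Matrix.smul_mul, ← Matrix.mul_smul, hD, hM]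
  calc ρ' = (U * Uᴴ) * ρ' * (U * Uᴴ) := by rw [hUU]; simp
    _ = _ := by simp only [Matrix.mul_assoc]

open scoped MatrixOrder in
theorem _root_.Matrix.PosSemidef.exists_eq_mul_conjTranspose {A : Matrix ι ι ℂ}
    (hA : A.PosSemidef) : ∃ B : Matrix ι ι ℂ, A = B * Bᴴ := by
  classical
  have hs : (CFC.sqrt A).PosSemidef := Matrix.nonneg_iff_posSemidef.mp (CFC.sqrt_nonneg A)
  refine ⟨CFC.sqrt A, ?_⟩
  rw [hs.isHermitian.eq, CFC.sqrt_mul_sqrt_self A hA.nonneg]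

/-- A differentiable purification `ρ = W W†`, `ρ' = W' W† + W W'†` bounds the Fisher information
by `4 Tr (W' W'†)`: expand `Tr ((2 W' - L W) (2 W' - L W)†) ≥ 0`. -/
theorem qfi_le_of_purification {ρ : ℝ → Matrix ι ι ℂ} {ω : ℝ} {W W' : Matrix ι κ ℂ}
    (hρ : ρ ω = W * Wᴴ) (hρ' : matDeriv ρ ω = W' * Wᴴ + W * W'ᴴ) :
    qfi ρ ω ≤ ENNReal.ofReal (4 * (W' * W'ᴴ).trace.re) := by
  have hpos : (ρ ω).PosSemidef := hρ ▸ Matrix.posSemidef_self_mul_conjTranspose W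
  have hker : ∀ v, ρ ω *ᵥ v = 0 → Wᴴ *ᵥ v = 0 := by
    intro v hv
    rw [hρ] at hv
    rw [← dotProduct_star_self_eq_zero, Matrix.star_mulVec,
      ← Matrix.dotProduct_mulVec]
    simp [hv]
  obtain ⟨L, hL⟩ : ∃ L, IsSLD (ρ ω) (matDeriv ρ ω) L := by
    refine exists_isSLD hpos ?_ ?_
    · rw [hρ']
      simp [Matrix.IsHermitian, add_comm]
    · intro v w hv hw
      have hv' : star v ᵥ* W = 0 := by
        have := congrArg star (hker v hv)
        simpa [Matrix.star_mulVec] using this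
      rw [hρ', Matrix.add_mulVec, ← Matrix.mulVec_mulVec, ← Matrix.mulVec_mulVec, hker w hw,
        Matrix.mulVec_zero, zero_add, Matrix.dotProduct_mulVec, hv', zero_dotProduct]
  rw [hL.qfi_eq]
  refine ENNReal.ofReal_le_ofReal ?_
  have hnn := (Matrix.posSemidef_self_mul_conjTranspose ((2 : ℂ) • W' - L * W)).trace_nonneg
  have hLH : Lᴴ = L := hL.1
  have hLρ' : (L * matDeriv ρ ω).trace = (L * L * ρ ω).trace := by
    have hc : (L * ρ ω * L).trace = (L * L * ρ ω).trace := by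
      rw [Matrix.trace_mul_comm, Matrix.mul_assoc]
    rw [hL.2, Matrix.mul_smul, Matrix.mul_add, ← Matrix.mul_assoc, ← Matrix.mul_assoc,
      Matrix.trace_smul, Matrix.trace_add, hc, smul_eq_mul]
    ring
  have key : (((2 : ℂ) • W' - L * W) * ((2 : ℂ) • W' - L * W)ᴴ).trace
      = 4 * (W' * W'ᴴ).trace - (L * L * ρ ω).trace := by
    have h1 : (W' * (Wᴴ * L)).trace = (L * (W' * Wᴴ)).trace := by
      rw [← Matrix.mul_assoc, Matrix.trace_mul_comm]
    have h2 : (L * (W * (Wᴴ * L))).trace = (L * (L * (W * Wᴴ))).trace := by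
      rw [Matrix.trace_mul_comm, Matrix.trace_mul_comm L]
      rw [Matrix.trace_mul_comm]
      simp only [Matrix.mul_assoc]
    have h3 := hLρ'
    rw [hρ, hρ', Matrix.mul_add, Matrix.trace_add, Matrix.mul_assoc] at h3
    simp only [Matrix.conjTranspose_sub, Matrix.conjTranspose_smul, Matrix.conjTranspose_mul, hLH,
      Matrix.sub_mul, Matrix.mul_sub, Matrix.trace_sub, Matrix.smul_mul, Matrix.mul_smul,
      Matrix.trace_smul, hρ, smul_eq_mul, Matrix.mul_assoc, h1, h2]
    simp only [star_ofNat]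
    linear_combination (-2 : ℂ) * h3
  rw [key] at hnn
  have := (Complex.le_def.mp hnn).1
  simp at this
  linarith

/-- If `C D + D C = 0` then `Tr (D C D) = -Tr (D C D)`, so the positive matrix `D C D` vanishes. -/
theorem mul_eq_zero_of_anticommute {C D : Matrix ι ι ℂ} (hC : C.PosSemidef)
    (hD : D.IsHermitian) (h : C * D + D * C = 0) : C * D = 0 := by
  obtain ⟨B, rfl⟩ := hC.exists_eq_mul_conjTranspose
  set C := B * Bᴴ with hCdef
  have hps : (D * C * D).PosSemidef := by
    have := hC.mul_mul_conjTranspose_same D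
    rwa [hD.eq] at this
  have htr : (D * C * D).trace = 0 := by
    have h1 : (D * C * D).trace = (C * D * D).trace := by
      rw [Matrix.mul_assoc, Matrix.trace_mul_comm]
    have h2 : (D * C * D).trace + (C * D * D).trace = 0 := by
      rw [← Matrix.trace_add, ← Matrix.add_mul, add_comm, h, Matrix.zero_mul, Matrix.trace_zero]
    rw [← h1] at h2
    linear_combination h2 / 2
  have hz := hps.trace_eq_zero_iff.mp htr
  have hBD : Bᴴ * D = 0 := by
    rw [← Matrix.conjTranspose_mul_self_eq_zero, ← hz, hCdef, Matrix.conjTranspose_mul, hD.eq,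
      Matrix.conjTranspose_conjTranspose]
    simp only [Matrix.mul_assoc]
  rw [hCdef, Matrix.mul_assoc, hBD, Matrix.mul_zero]

/-- A unitary symmetry of `ρ` and `ρ'` is a symmetry of `L ρ` and `L ρ L` for every symmetric
logarithmic derivative `L`, even though `L` itself need not be invariant: `D = G L G† - L`
anticommutes with `ρ`, hence `ρ D = D ρ = 0`. -/
theorem IsSLD.conj_invariant [DecidableEq ι] {ρ ρ' L G : Matrix ι ι ℂ} (hL : IsSLD ρ ρ' L)
    (hρ : ρ.PosSemidef) (hG : Gᴴ * G = 1) (h : G * ρ * Gᴴ = ρ) (h' : G * ρ' * Gᴴ = ρ') :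
    G * (L * ρ) * Gᴴ = L * ρ ∧ G * (L * ρ * L) * Gᴴ = L * ρ * L := by
  set L₁ := G * L * Gᴴ with hL₁
  have hconj : ∀ A B : Matrix ι ι ℂ, G * (A * B) * Gᴴ = (G * A * Gᴴ) * (G * B * Gᴴ) := by
    intro A B
    calc _ = G * A * 1 * B * Gᴴ := by simp only [Matrix.mul_assoc, Matrix.one_mul]
      _ = _ := by rw [← hG]; simp only [Matrix.mul_assoc]
  have hL₁H : L₁.IsHermitian := Matrix.isHermitian_mul_mul_conjTranspose G hL.1
  have hDH : (L₁ - L).IsHermitian := hL₁H.sub hL.1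
  have hanti : ρ * (L₁ - L) + (L₁ - L) * ρ = 0 := by
    have e := h'
    rw [hL.2, Matrix.mul_smul, Matrix.smul_mul, Matrix.mul_add, Matrix.add_mul, hconj, hconj,
      h, ← hL₁] at e
    have e2 : ρ * L₁ + L₁ * ρ = ρ * L + L * ρ :=
      smul_right_injective _ (by norm_num : (1 / 2 : ℂ) ≠ 0) e
    rw [Matrix.mul_sub, Matrix.sub_mul, ← sub_eq_zero.mpr e2]
    abel
  have hρD := mul_eq_zero_of_anticommute hρ hDH hanti
  have hDρ : (L₁ - L) * ρ = 0 := by rwa [hρD, zero_add] at hanti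
  have e1 : L₁ * ρ = L * ρ := by rwa [Matrix.sub_mul, sub_eq_zero] at hDρ
  have e2 : ρ * L₁ = ρ * L := by rwa [Matrix.mul_sub, sub_eq_zero] at hρD
  refine ⟨by rw [hconj, h, e1], ?_⟩
  rw [hconj, hconj, h, ← hL₁, e1, Matrix.mul_assoc, e2, Matrix.mul_assoc]

/-- Where `v` is in the kernel of `ρ_ω`, the function `t ↦ ⟨v, ρ_t v⟩ ≥ 0` has a minimum at `ω`;
hence the quadratic form of `ρ'_ω` vanishes on that kernel. -/
theorem exists_isSLD_matDeriv {ρ : ℝ → Matrix ι ι ℂ} {ω : ℝ}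
    (hρ : ∀ᶠ t in 𝓝 ω, (ρ t).PosSemidef)
    (hd : ∀ i j, DifferentiableAt ℝ (fun t => ρ t i j) ω) :
    ∃ L, IsSLD (ρ ω) (matDeriv ρ ω) L := by
  have hder : ∀ v w : ι → ℂ, HasDerivAt (fun t => star v ⬝ᵥ (ρ t *ᵥ w))
      (star v ⬝ᵥ (matDeriv ρ ω *ᵥ w)) ω := by
    intro v w
    simp only [dotProduct, Matrix.mulVec, matDeriv_apply]
    exact HasDerivAt.fun_sum fun i _ => HasDerivAt.const_mul _
      (HasDerivAt.fun_sum fun j _ => (hd i j).hasDerivAt.mul_const _)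
  have hdiag : ∀ v, ρ ω *ᵥ v = 0 → star v ⬝ᵥ (matDeriv ρ ω *ᵥ v) = 0 := by
    intro v hv
    have hre := Complex.reCLM.hasFDerivAt.comp_hasDerivAt ω (hder v v)
    have him := Complex.imCLM.hasFDerivAt.comp_hasDerivAt ω (hder v v)
    have hmin : IsLocalMin (fun t => (star v ⬝ᵥ (ρ t *ᵥ v)).re) ω := by
      filter_upwards [hρ] with t ht
      have := (Complex.le_def.mp (ht.dotProduct_mulVec_nonneg v)).1
      simpa [hv] using this
    have him0 : (fun t => (star v ⬝ᵥ (ρ t *ᵥ v)).im) =ᶠ[𝓝 ω] fun _ => 0 := by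
      filter_upwards [hρ] with t ht
      exact (Complex.le_def.mp (ht.dotProduct_mulVec_nonneg v)).2.symm
    apply Complex.ext
    · exact hmin.hasDerivAt_eq_zero hre
    · exact (him.congr_of_eventuallyEq him0.symm).unique (hasDerivAt_const ω (0 : ℝ))
  refine exists_isSLD hρ.self_of_nhds ?_ ?_
  · ext i j
    rw [Matrix.conjTranspose_apply, matDeriv_apply, matDeriv_apply]
    have h1 := (hd j i).hasDerivAt.star
    have h2 : (fun t => ρ t i j) =ᶠ[𝓝 ω] fun t => star (ρ t j i) := by
      filter_upwards [hρ] with t ht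
      exact (ht.isHermitian.apply i j).symm
    exact ((h1.congr_of_eventuallyEq h2).deriv).symm
  · intro v w hv hw
    have h1 := hdiag (v + w) (by rw [Matrix.mulVec_add, hv, hw, add_zero])
    have h2 := hdiag (v + Complex.I • w)
      (by rw [Matrix.mulVec_add, Matrix.mulVec_smul, hv, hw, smul_zero, add_zero])
    simp only [star_add, star_smul, Matrix.mulVec_add, Matrix.mulVec_smul, add_dotProduct,
      dotProduct_add, smul_dotProduct, dotProduct_smul, hdiag v hv, hdiag w hw, smul_eq_mul,
      RCLike.star_def, Complex.conj_I] at h1 h2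
    -- polarization: `h1` gives `b v w + b w v = 0` and `h2` gives `b v w - b w v = 0`
    have hI := Complex.I_mul_I
    linear_combination (1 / 2 : ℂ) * h1 - Complex.I / 2 * h2
      + (star v ⬝ᵥ (matDeriv ρ ω *ᵥ w) - star w ⬝ᵥ (matDeriv ρ ω *ᵥ v)) / 2 * hI

theorem matDeriv_conj {X : ℝ → Matrix ι ι ℂ} {ω : ℝ}
    (hX : ∀ i j, DifferentiableAt ℝ (fun t => X t i j) ω) (G : Matrix ι ι ℂ)
    (h : ∀ᶠ t in 𝓝 ω, G * X t * Gᴴ = X t) :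
    G * matDeriv X ω * Gᴴ = matDeriv X ω := by
  ext i j
  have h1 : HasDerivAt (fun t => (G * X t * Gᴴ) i j) ((G * matDeriv X ω * Gᴴ) i j) ω := by
    simp only [Matrix.mul_apply]
    exact HasDerivAt.fun_sum fun k _ => HasDerivAt.mul_const
      (HasDerivAt.fun_sum fun l _ => (hX l k).hasDerivAt.const_mul _) _
  have h2 : (fun t => (G * X t * Gᴴ) i j) =ᶠ[𝓝 ω] fun t => X t i j := by
    filter_upwards [h] with t ht
    rw [ht]
  exact h1.unique ((hX i j).hasDerivAt.congr_of_eventuallyEq h2)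

theorem qfi_le_qfi_submatrix {ρ : ℝ → Matrix ι ι ℂ} {ω : ℝ} (e : κ ≃ ι) :
    qfi ρ ω ≤ qfi (fun t => (ρ t).submatrix e e) ω := by
  refine le_iInf₂ fun L hL => ?_
  have hsub : ∀ A : Matrix κ κ ℂ, (A.submatrix e.symm e.symm).submatrix e e = A := by
    intro A; ext; simp
  obtain ⟨M, rfl⟩ : ∃ M : Matrix ι ι ℂ, L = M.submatrix e e := ⟨_, (hsub L).symm⟩
  have hinj : ∀ A B : Matrix ι ι ℂ, A.submatrix e e = B.submatrix e e → A = B := by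
    intro A B h
    ext i j
    simpa using congrFun (congrFun h (e.symm i)) (e.symm j)
  have hM : IsSLD (ρ ω) (matDeriv ρ ω) M := by
    refine ⟨hinj _ _ hL.1, hinj _ _ ?_⟩
    have := hL.2
    simp only [Matrix.submatrix_mul_equiv] at this
    exact this
  rw [hM.qfi_eq]
  simp only [Matrix.submatrix_mul_equiv]
  refine le_of_eq ?_
  congr 2
  exact (Equiv.sum_comp e fun i => (M * M * ρ ω) i i).symm

end SLD

/-! ### Choi matrices and the optimality criterion for the maximally entangled input -/

section Choi

variable {n n' a : Type*}

/-- The (unnormalized) Choi matrix `∑ E(|s⟩⟨t|) ⊗ |s⟩⟨t|`, with index pairs (output, input). -/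
def choi [DecidableEq n] (E : Matrix n n ℂ →ₗ[ℂ] Matrix n' n' ℂ) :
    Matrix (n' × n) (n' × n) ℂ :=
  Matrix.of fun x y => E (Matrix.single x.2 y.2 1) x.1 y.1

/-- Partial trace over the first (output) factor. -/
def traceOut [Fintype n'] (X : Matrix (n' × n) (n' × n) ℂ) : Matrix n n ℂ :=
  Matrix.of fun s t => ∑ i, X (i, s) (i, t)

/-- Contraction of the input index of `X` with the probe index of `ρ`. Applied to the Choi matrix
of `E` it gives `(E ⊗ 𝟙)(ρ)`. -/
def contract [Fintype n] (ρ : Matrix (n × a) (n × a) ℂ) (X : Matrix (n' × n) (n' × n) ℂ) :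
    Matrix (n' × a) (n' × a) ℂ :=
  Matrix.of fun x y => ∑ s, ∑ t, ρ (s, x.2) (t, y.2) * X (x.1, s) (y.1, t)

theorem apply_eq_sum_choi [Fintype n] [DecidableEq n] (E : Matrix n n ℂ →ₗ[ℂ] Matrix n' n' ℂ)
    (A : Matrix n n ℂ) (i j : n') : E A i j = ∑ s, ∑ t, A s t * choi E (i, s) (j, t) := by
  conv_lhs => rw [Matrix.matrix_eq_sum_single A]
  simp only [map_sum, Matrix.sum_apply]
  refine Finset.sum_congr rfl fun s _ => Finset.sum_congr rfl fun t _ => ?_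
  have : Matrix.single s t (A s t) = A s t • Matrix.single s t (1 : ℂ) := by simp
  rw [this, map_smul]
  simp [choi]

theorem withAncilla_eq_contract [Fintype n] [DecidableEq n]
    (E : Matrix n n ℂ →ₗ[ℂ] Matrix n' n' ℂ) (ρ : Matrix (n × a) (n × a) ℂ) :
    withAncilla a E ρ = contract ρ (choi E) := by
  ext x y
  simp [withAncilla, contract, apply_eq_sum_choi E]

theorem withAncilla_maxEntangled [Fintype n] [DecidableEq n]
    (E : Matrix n n ℂ →ₗ[ℂ] Matrix n' n' ℂ) :
    withAncilla n E (maxEntangled n) = (Fintype.card n : ℂ)⁻¹ • choi E := by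
  rw [withAncilla_eq_contract]
  ext x y
  simp [contract, maxEntangled, ite_and]

theorem trace_eq_trace_traceOut [Fintype n] [Fintype n'] (X : Matrix (n' × n) (n' × n) ℂ) :
    X.trace = (traceOut X).trace := by
  simp only [Matrix.trace, Matrix.diag_apply, traceOut, Matrix.of_apply]
  rw [Fintype.sum_prod_type, Finset.sum_comm]

theorem contract_add [Fintype n] (ρ : Matrix (n × a) (n × a) ℂ)
    (X Y : Matrix (n' × n) (n' × n) ℂ) :
    contract ρ (X + Y) = contract ρ X + contract ρ Y := by
  ext x y
  simp [contract, mul_add, Finset.sum_add_distrib]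

theorem trace_contract [Fintype n] [Fintype n'] [Fintype a] [DecidableEq n]
    (ρ : Matrix (n × a) (n × a) ℂ) (X : Matrix (n' × n) (n' × n) ℂ) {c : ℂ}
    (hX : traceOut X = c • 1) : (contract ρ X).trace = c * ρ.trace := by
  have hX' : ∀ s t, ∑ i, X (i, s) (i, t) = if s = t then c else 0 := by
    intro s t
    have := congrFun (congrFun hX s) t
    simpa [traceOut, Matrix.one_apply] using this
  simp only [Matrix.trace, Matrix.diag_apply, contract, Matrix.of_apply]
  rw [Fintype.sum_prod_type, Finset.sum_comm]
  have h1 : ∀ u : a, ∑ i, ∑ s, ∑ t, ρ (s, u) (t, u) * X (i, s) (i, t)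
      = c * ∑ s, ρ (s, u) (s, u) := by
    intro u
    rw [Finset.sum_comm, Finset.mul_sum]
    refine Finset.sum_congr rfl fun s _ => ?_
    rw [Finset.sum_comm]
    simp_rw [← Finset.mul_sum, hX']
    simp [mul_comm]
  simp_rw [h1]
  rw [← Finset.mul_sum, Fintype.sum_prod_type, Finset.sum_comm]

/-- Contraction with `R R†` acts as `B ↦ W_B`, with `contract (R R†) (A B†) = W_A W_B†`. -/
def contractFactor {κ μ : Type*} [Fintype n] (R : Matrix (n × a) κ ℂ) (B : Matrix (n' × n) μ ℂ) :
    Matrix (n' × a) (κ × μ) ℂ :=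
  Matrix.of fun x z => ∑ s, R (s, x.2) z.1 * B (x.1, s) z.2

theorem contract_mul_conjTranspose {κ μ : Type*} [Fintype n] [Fintype κ] [Fintype μ]
    (R : Matrix (n × a) κ ℂ) (A B : Matrix (n' × n) μ ℂ) :
    contract (R * Rᴴ) (A * Bᴴ) = contractFactor R A * (contractFactor R B)ᴴ := by
  ext x y
  simp only [contract, contractFactor, Matrix.of_apply, Matrix.mul_apply,
    Matrix.conjTranspose_apply, star_sum, star_mul']
  simp_rw [Finset.sum_mul_sum]
  rw [Fintype.sum_prod_type]
  have h : ∀ s t, (∑ k, ∑ m, R (s, x.2) k * star (R (t, y.2) k) *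
      (A (x.1, s) m * star (B (y.1, t) m))) = ∑ k, ∑ m, R (s, x.2) k * A (x.1, s) m *
      (star (R (t, y.2) k) * star (B (y.1, t) m)) := fun s t =>
    Finset.sum_congr rfl fun k _ => Finset.sum_congr rfl fun m _ => by ring
  simp_rw [h]
  calc _ = ∑ s, ∑ k, ∑ t, ∑ m, R (s, x.2) k * A (x.1, s) m *
      (star (R (t, y.2) k) * star (B (y.1, t) m)) :=
        Finset.sum_congr rfl fun s _ => Finset.sum_comm
    _ = ∑ k, ∑ s, ∑ t, ∑ m, R (s, x.2) k * A (x.1, s) m *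
      (star (R (t, y.2) k) * star (B (y.1, t) m)) := Finset.sum_comm
    _ = ∑ k, ∑ s, ∑ m, ∑ t, R (s, x.2) k * A (x.1, s) m *
      (star (R (t, y.2) k) * star (B (y.1, t) m)) :=
        Finset.sum_congr rfl fun k _ => Finset.sum_congr rfl fun s _ => Finset.sum_comm
    _ = _ := Finset.sum_congr rfl fun k _ => Finset.sum_comm

theorem matDeriv_contract [Fintype n] (ρ : Matrix (n × a) (n × a) ℂ)
    {X : ℝ → Matrix (n' × n) (n' × n) ℂ} {ω : ℝ}
    (hX : ∀ x y, DifferentiableAt ℝ (fun t => X t x y) ω) :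
    matDeriv (fun t => contract ρ (X t)) ω = contract ρ (matDeriv X ω) := by
  ext x y
  rw [matDeriv_apply]
  simp only [contract, Matrix.of_apply]
  exact (HasDerivAt.fun_sum fun s _ => HasDerivAt.fun_sum fun t _ =>
    (hX _ _).hasDerivAt.const_mul _).deriv

/-- If `L` is a symmetric logarithmic derivative of the Choi matrix `C` and the partial trace of
`L C L` is `c 𝟙`, then no input does better than `c`: for `ρ = R R†` and `C = B B†` the matrices
`W_B` and `W_{L B / 2}` purify the output state and its derivative. -/
theorem qfi_withAncilla_le [Fintype n] [DecidableEq n] [Fintype n'] [Fintype a]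
    {E : ℝ → Matrix n n ℂ →ₗ[ℂ] Matrix n' n' ℂ} {ω c : ℝ} {L : Matrix (n' × n) (n' × n) ℂ}
    (hC : (choi (E ω)).PosSemidef)
    (hd : ∀ x y, DifferentiableAt ℝ (fun t => choi (E t) x y) ω)
    (hL : IsSLD (choi (E ω)) (matDeriv (fun t => choi (E t)) ω) L)
    (hc : traceOut (L * choi (E ω) * L) = (c : ℂ) • 1)
    {ρ : Matrix (n × a) (n × a) ℂ} (hρ : IsDensity ρ) :
    qfi (fun t => withAncilla a (E t) ρ) ω ≤ ENNReal.ofReal c := by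
  obtain ⟨B, hB⟩ := hC.exists_eq_mul_conjTranspose
  obtain ⟨R, hR⟩ := hρ.1.exists_eq_mul_conjTranspose
  set B' := (1 / 2 : ℂ) • (L * B) with hB'
  have hLH : Lᴴ = L := hL.1
  have hconj : B'ᴴ = (1 / 2 : ℂ) • (Bᴴ * L) := by
    rw [hB', Matrix.conjTranspose_smul, Matrix.conjTranspose_mul, hLH]
    simp
  have hderiv : matDeriv (fun t => choi (E t)) ω = B' * Bᴴ + B * B'ᴴ := by
    rw [hL.2, hconj, hB', hB, Matrix.smul_mul, Matrix.mul_smul, ← smul_add, add_comm]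
    simp only [Matrix.mul_assoc]
  have hB'B' : B' * B'ᴴ = (1 / 4 : ℂ) • (L * choi (E ω) * L) := by
    rw [hconj, hB', hB, Matrix.smul_mul, Matrix.mul_smul, smul_smul]
    norm_num [Matrix.mul_assoc]
  refine (qfi_le_of_purification (W := contractFactor R B) (W' := contractFactor R B')
    ?_ ?_).trans_eq ?_
  · rw [withAncilla_eq_contract, hB, hR, contract_mul_conjTranspose]
  · simp_rw [withAncilla_eq_contract]
    rw [matDeriv_contract ρ hd, hderiv, contract_add, hR, contract_mul_conjTranspose,
      contract_mul_conjTranspose]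
  · have h : traceOut (B' * B'ᴴ) = ((1 / 4 : ℂ) * c) • 1 := by
      rw [hB'B', mul_smul, ← hc]
      ext s t
      simp [traceOut, Finset.mul_sum]
    rw [← contract_mul_conjTranspose, ← hR, trace_contract ρ _ h, hρ.2]
    congr 1
    simp

theorem isDensity_maxEntangled [Fintype n] [DecidableEq n] [Nonempty n] :
    IsDensity (maxEntangled n) := by
  have hcard : (Fintype.card n : ℂ) ≠ 0 := by exact_mod_cast Fintype.card_ne_zero
  constructor
  · have h : maxEntangled n = (Fintype.card n : ℂ)⁻¹ •
        Matrix.vecMulVec (fun x : n × n => if x.1 = x.2 then (1 : ℂ) else 0)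
          (star fun x : n × n => if x.1 = x.2 then (1 : ℂ) else 0) := by
      ext x y
      simp only [maxEntangled, Matrix.of_apply, Matrix.smul_apply, Matrix.vecMulVec_apply,
        Pi.star_apply, smul_eq_mul]
      by_cases h1 : x.1 = x.2 <;> by_cases h2 : y.1 = y.2 <;> simp [h1, h2]
    rw [h]
    refine (Matrix.posSemidef_vecMulVec_self_star _).smul ?_
    rw [← Complex.ofReal_natCast, ← Complex.ofReal_inv, Complex.zero_le_real]
    positivity
  · simp only [Matrix.trace, Matrix.diag_apply, maxEntangled, Matrix.of_apply, and_self]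
    rw [Fintype.sum_prod_type]
    simp [hcard]

theorem qfi_withAncilla_maxEntangled [Fintype n] [DecidableEq n] [Fintype n'] [Nonempty n]
    {E : ℝ → Matrix n n ℂ →ₗ[ℂ] Matrix n' n' ℂ} {ω c : ℝ} {L : Matrix (n' × n) (n' × n) ℂ}
    (hd : ∀ x y, DifferentiableAt ℝ (fun t => choi (E t) x y) ω)
    (hL : IsSLD (choi (E ω)) (matDeriv (fun t => choi (E t)) ω) L)
    (hc : traceOut (L * choi (E ω) * L) = (c : ℂ) • 1) :
    qfi (fun t => withAncilla n (E t) (maxEntangled n)) ω = ENNReal.ofReal c := by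
  have hcard : (Fintype.card n : ℂ) ≠ 0 := by exact_mod_cast Fintype.card_ne_zero
  have hL' : IsSLD (withAncilla n (E ω) (maxEntangled n))
      (matDeriv (fun t => withAncilla n (E t) (maxEntangled n)) ω) L := by
    refine ⟨hL.1, ?_⟩
    have h : matDeriv (fun t => withAncilla n (E t) (maxEntangled n)) ω
        = (Fintype.card n : ℂ)⁻¹ • matDeriv (fun t => choi (E t)) ω := by
      ext x y
      simp_rw [withAncilla_maxEntangled]
      exact ((hd x y).hasDerivAt.const_mul _).deriv
    rw [h, hL.2, withAncilla_maxEntangled, Matrix.smul_mul, Matrix.mul_smul, ← smul_add, smul_comm]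
  rw [hL'.qfi_eq]
  congr 1
  have htr : (L * L * choi (E ω)).trace = c * Fintype.card n := by
    rw [Matrix.mul_assoc, Matrix.trace_mul_comm, trace_eq_trace_traceOut, hc]
    simp
  rw [withAncilla_maxEntangled, Matrix.mul_smul, Matrix.trace_smul, htr, smul_eq_mul,
    mul_comm, mul_assoc, mul_inv_cancel₀ hcard, mul_one, Complex.ofReal_re]

theorem qfi_withAncilla_le_channelQFI [Fintype n] [Fintype n'] [Fintype a]
    (E : ℝ → Matrix n n ℂ →ₗ[ℂ] Matrix n' n' ℂ) (ω : ℝ) {ρ : Matrix (n × a) (n × a) ℂ}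
    (hρ : IsDensity ρ) : qfi (fun t => withAncilla a (E t) ρ) ω ≤ channelQFI E ω := by
  let e := (Fintype.equivFin a).symm
  let f : n × Fin (Fintype.card a) ≃ n × a := (Equiv.refl n).prodCongr e
  have hρ' : IsDensity (ρ.submatrix f f) := by
    refine ⟨hρ.1.submatrix f, ?_⟩
    rw [← hρ.2]
    exact Equiv.sum_comp f fun i => ρ i i
  refine (qfi_le_qfi_submatrix ((Equiv.refl n').prodCongr e)).trans ?_
  exact le_iSup_of_le (Fintype.card a) (le_iSup₂_of_le (ρ.submatrix f f) hρ' le_rfl)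

/-- When the partial trace of `L C L` over the output is `c 𝟙`, the maximally entangled input is
optimal and the channel Fisher information is `c`. -/
theorem isOptimalInput_maxEntangled [Fintype n] [DecidableEq n] [Fintype n'] [Nonempty n]
    {E : ℝ → Matrix n n ℂ →ₗ[ℂ] Matrix n' n' ℂ} {ω c : ℝ} {L : Matrix (n' × n) (n' × n) ℂ}
    (hC : (choi (E ω)).PosSemidef)
    (hd : ∀ x y, DifferentiableAt ℝ (fun t => choi (E t) x y) ω)
    (hL : IsSLD (choi (E ω)) (matDeriv (fun t => choi (E t)) ω) L)
    (hc : traceOut (L * choi (E ω) * L) = (c : ℂ) • 1) :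
    IsOptimalInput E ω (maxEntangled n) ∧ channelQFI E ω = ENNReal.ofReal c := by
  have h1 := qfi_withAncilla_maxEntangled hd hL hc
  have h2 : channelQFI E ω ≤ ENNReal.ofReal c :=
    iSup_le fun m => iSup₂_le fun ρ hρ => qfi_withAncilla_le hC hd hL hc hρ
  have h3 := qfi_withAncilla_le_channelQFI E ω (isDensity_maxEntangled (n := n))
  rw [h1] at h3
  have h4 := le_antisymm h2 h3
  exact ⟨⟨isDensity_maxEntangled, by rw [h1, h4]⟩, h4⟩

end Choi

/-! ### Channels, covariance and 1-designs -/

section Channel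

variable {n n' : Type*} [Fintype n]

theorem kraus_apply_single [DecidableEq n] {E : Matrix n n ℂ →ₗ[ℂ] Matrix n' n' ℂ} {r : ℕ}
    {K : Fin r → Matrix n' n ℂ} (hE : ∀ ρ, E ρ = ∑ k, K k * ρ * (K k)ᴴ) (s t : n) (i j : n') :
    E (Matrix.single s t 1) i j = ∑ k, K k i s * star (K k j t) := by
  rw [hE, Matrix.sum_apply]
  refine Finset.sum_congr rfl fun k _ => ?_
  rw [Matrix.mul_apply]
  simp [Matrix.mul_apply, Matrix.single_apply, ite_and]

theorem IsQuantumChannel.choi_posSemidef [DecidableEq n] [Fintype n']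
    {E : Matrix n n ℂ →ₗ[ℂ] Matrix n' n' ℂ}
    (hE : IsQuantumChannel E) : (choi E).PosSemidef := by
  obtain ⟨r, K, -, hK⟩ := hE
  have h : choi E = ∑ k, Matrix.vecMulVec (fun x : n' × n => K k x.1 x.2)
      (star fun x : n' × n => K k x.1 x.2) := by
    ext x y
    rw [Matrix.sum_apply]
    exact kraus_apply_single hK _ _ _ _
  rw [h]
  exact Matrix.posSemidef_sum _ fun k _ => Matrix.posSemidef_vecMulVec_self_star _

theorem IsQuantumChannel.traceOut_choi [DecidableEq n] [Fintype n']
    {E : Matrix n n ℂ →ₗ[ℂ] Matrix n' n' ℂ}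
    (hE : IsQuantumChannel E) : traceOut (choi E) = 1 := by
  obtain ⟨r, K, hK1, hK⟩ := hE
  ext s t
  have h := congrFun (congrFun hK1 t) s
  simp only [Matrix.sum_apply, Matrix.mul_apply, Matrix.conjTranspose_apply] at h
  simp only [traceOut, Matrix.of_apply, choi, kraus_apply_single hK]
  rw [Finset.sum_comm]
  simp_rw [mul_comm (K _ _ _)]
  rw [h]
  simp [Matrix.one_apply, eq_comm]

open scoped Kronecker in
/-- The symmetry `G = V ⊗ Ū` of the Choi matrix of a channel with
`E(U ρ U†) = V E(ρ) V†`. -/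
def choiSymmetry (V : Matrix n' n' ℂ) (U : Matrix n n ℂ) : Matrix (n' × n) (n' × n) ℂ :=
  V ⊗ₖ U.map star

theorem choiSymmetry_conj_apply [Fintype n'] (V : Matrix n' n' ℂ) (U : Matrix n n ℂ)
    (X : Matrix (n' × n) (n' × n) ℂ) (x y : n' × n) :
    (choiSymmetry V U * X * (choiSymmetry V U)ᴴ) x y
      = ∑ s, ∑ t, star (U x.2 s) * U y.2 t *
        (V * (Matrix.of fun i j => X (i, s) (j, t)) * Vᴴ) x.1 y.1 := by
  simp only [Matrix.mul_apply, choiSymmetry, Matrix.kroneckerMap_apply, Matrix.conjTranspose_apply,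
    Matrix.map_apply, Fintype.sum_prod_type, Matrix.of_apply, star_mul', star_star,
    Finset.sum_mul, Finset.mul_sum]
  calc _ = ∑ j, ∑ s, ∑ t, ∑ i, V x.1 i * star (U x.2 s) * X (i, s) (j, t) *
          (star (V y.1 j) * U y.2 t) := by
        refine Finset.sum_congr rfl fun j _ => ?_
        rw [Finset.sum_comm_cycle]
    _ = ∑ s, ∑ j, ∑ t, ∑ i, V x.1 i * star (U x.2 s) * X (i, s) (j, t) *
          (star (V y.1 j) * U y.2 t) := Finset.sum_comm
    _ = ∑ s, ∑ t, ∑ j, ∑ i, V x.1 i * star (U x.2 s) * X (i, s) (j, t) *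
          (star (V y.1 j) * U y.2 t) := Finset.sum_congr rfl fun s _ => Finset.sum_comm
    _ = _ := by
        refine Finset.sum_congr rfl fun s _ => Finset.sum_congr rfl fun t _ =>
          Finset.sum_congr rfl fun j _ => Finset.sum_congr rfl fun i _ => ?_
        ring

theorem choiSymmetry_conj_choi [DecidableEq n] [Fintype n'] {E : Matrix n n ℂ →ₗ[ℂ] Matrix n' n' ℂ}
    {V : Matrix n' n' ℂ} {U : Matrix n n ℂ} (hU : U * Uᴴ = 1)
    (h : ∀ ρ, E (U * ρ * Uᴴ) = V * E ρ * Vᴴ) :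
    choiSymmetry V U * choi E * (choiSymmetry V U)ᴴ = choi E := by
  ext x y
  rw [choiSymmetry_conj_apply]
  have h1 : ∀ s t, (V * (Matrix.of fun i j => choi E (i, s) (j, t)) * Vᴴ)
      = E (U * Matrix.single s t 1 * Uᴴ) := by
    intro s t
    have : (Matrix.of fun i j => choi E (i, s) (j, t)) = E (Matrix.single s t 1) := rfl
    rw [this, h]
  simp_rw [h1]
  -- `∑ s t, conj (U x s) (U y t) U |s⟩⟨t| U† = |x⟩⟨y|`
  have h2 : ∑ s, ∑ t, (star (U x.2 s) * U y.2 t) • (U * Matrix.single s t 1 * Uᴴ)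
      = Matrix.single x.2 y.2 1 := by
    have h3 : ∑ s, ∑ t, (star (U x.2 s) * U y.2 t) • Matrix.single s t (1 : ℂ)
        = Uᴴ * Matrix.single x.2 y.2 1 * U := by
      ext a b
      simp [Matrix.sum_apply, Matrix.mul_apply, Matrix.single_apply, ite_and]
    calc _ = U * (∑ s, ∑ t, (star (U x.2 s) * U y.2 t) • Matrix.single s t (1 : ℂ)) * Uᴴ := by
          simp only [Finset.mul_sum, Finset.sum_mul, Matrix.mul_smul, Matrix.smul_mul]
      _ = (U * Uᴴ) * Matrix.single x.2 y.2 1 * (U * Uᴴ) := by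
          rw [h3]; simp only [Matrix.mul_assoc]
      _ = _ := by rw [hU, Matrix.one_mul, Matrix.mul_one]
  have h4 := congrFun (congrFun (congrArg E h2) x.1) y.1
  simpa [map_sum, Matrix.sum_apply, choi] using h4

open scoped Kronecker in
theorem choiSymmetry_conjTranspose_mul [DecidableEq n] [Fintype n'] [DecidableEq n']
    {V : Matrix n' n' ℂ} {U : Matrix n n ℂ}
    (hV : Vᴴ * V = 1) (hU : Uᴴ * U = 1) : (choiSymmetry V U)ᴴ * choiSymmetry V U = 1 := by
  have h : (U.map star)ᴴ * U.map star = 1 := by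
    have := congrArg (fun A : Matrix n n ℂ => A.map star) hU
    ext i j
    have := congrFun (congrFun this i) j
    simpa [Matrix.mul_apply, Matrix.one_apply, apply_ite] using this
  rw [choiSymmetry, Matrix.conjTranspose_kronecker, ← Matrix.mul_kronecker_mul, hV, h,
    Matrix.one_kronecker_one]

theorem traceOut_choiSymmetry_conj [Fintype n'] [DecidableEq n'] {V : Matrix n' n' ℂ}
    (hV : Vᴴ * V = 1) (U : Matrix n n ℂ) (X : Matrix (n' × n) (n' × n) ℂ) :
    traceOut (choiSymmetry V U * X * (choiSymmetry V U)ᴴ)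
      = (U * (traceOut X).map star * Uᴴ).map star := by
  have htr : ∀ s t, ∑ i, (V * (Matrix.of fun i j => X (i, s) (j, t)) * Vᴴ) i i
      = traceOut X s t := by
    intro s t
    change (V * (Matrix.of fun i j => X (i, s) (j, t)) * Vᴴ).trace = _
    rw [Matrix.trace_mul_comm, ← Matrix.mul_assoc, hV, Matrix.one_mul]
    rfl
  ext a b
  have : traceOut (choiSymmetry V U * X * (choiSymmetry V U)ᴴ) a b
      = ∑ s, ∑ t, star (U a s) * U b t * traceOut X s t := by
    rw [traceOut, Matrix.of_apply]
    simp_rw [choiSymmetry_conj_apply]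
    rw [Finset.sum_comm]
    refine Finset.sum_congr rfl fun s _ => ?_
    rw [Finset.sum_comm]
    refine Finset.sum_congr rfl fun t _ => ?_
    rw [← Finset.mul_sum, htr]
  rw [this]
  simp only [Matrix.map_apply, Matrix.mul_apply, Matrix.conjTranspose_apply, star_sum, star_mul',
    star_star, Finset.sum_mul]
  rw [Finset.sum_comm]
  refine Finset.sum_congr rfl fun t _ => Finset.sum_congr rfl fun s _ => ?_
  ring

/-- The 1-design property turns invariance under every `Uᵢ` into being scalar. -/
theorem IsUnitaryOneDesign.eq_smul_one {d N : ℕ} {p : Fin N → ℝ}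
    {U : Fin N → Matrix (Fin d) (Fin d) ℂ} (hU : IsUnitaryOneDesign p U)
    {A : Matrix (Fin d) (Fin d) ℂ} (h : ∀ i, U i * A * (U i)ᴴ = A) :
    A = (A.trace / (d : ℂ)) • 1 := by
  rw [← hU.2.2.2 A]
  simp_rw [h, ← Finset.sum_smul]
  have : (∑ i, (p i : ℂ)) = 1 := by exact_mod_cast hU.2.1
  rw [this, one_smul]

theorem traceOut_eq_smul_one {d d' N : ℕ} {p : Fin N → ℝ}
    {U : Fin N → Matrix (Fin d) (Fin d) ℂ} (hU : IsUnitaryOneDesign p U)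
    {V : Fin N → Matrix (Fin d') (Fin d') ℂ} (hV : ∀ i, (V i)ᴴ * V i = 1)
    {X : Matrix (Fin d' × Fin d) (Fin d' × Fin d) ℂ}
    (h : ∀ i, choiSymmetry (V i) (U i) * X * (choiSymmetry (V i) (U i))ᴴ = X) :
    traceOut X = (X.trace / (d : ℂ)) • 1 := by
  have hss : ∀ A : Matrix (Fin d) (Fin d) ℂ, (A.map star).map star = A := by
    intro A; ext; simp
  have h1 : (traceOut X).map star = (((traceOut X).map star).trace / (d : ℂ)) • 1 := by
    refine hU.eq_smul_one fun i => ?_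
    have := traceOut_choiSymmetry_conj (hV i) (U i) X
    rw [h i] at this
    conv_rhs => rw [this, hss]
  rw [← hss (traceOut X), h1, trace_eq_trace_traceOut]
  ext s t
  rcases eq_or_ne s t with rfl | hst <;> simp [Matrix.trace, *]

/-- A jointly covariant family has a symmetric logarithmic derivative `L` of its Choi matrix `C`
for which the partial traces of `L C L` and of `L C` are scalar. The latter vanishes because
`Tr (L C) = Tr C' = 0`. -/
theorem exists_isSLD_choi_of_isJointlyCovariant {d d' N : ℕ} (p : Fin N → ℝ)
    {U : Fin N → Matrix (Fin d) (Fin d) ℂ} (hU : IsUnitaryOneDesign p U)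
    {Θ : Set ℝ} (hΘ : IsOpen Θ)
    {T : ℝ → Matrix (Fin d) (Fin d) ℂ →ₗ[ℂ] Matrix (Fin d') (Fin d') ℂ}
    (hT : ∀ ω ∈ Θ, IsQuantumChannel (T ω)) (hcov : IsJointlyCovariant (Set.range U) Θ T)
    {ω : ℝ} (hω : ω ∈ Θ) (hd : ∀ x y, DifferentiableAt ℝ (fun t => choi (T t) x y) ω) :
    ∃ (L : Matrix (Fin d' × Fin d) (Fin d' × Fin d) ℂ) (c : ℝ),
      IsSLD (choi (T ω)) (matDeriv (fun t => choi (T t)) ω) L ∧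
      traceOut (L * choi (T ω) * L) = (c : ℂ) • 1 ∧ traceOut (L * choi (T ω)) = 0 := by
  have hnear : ∀ᶠ t in 𝓝 ω, t ∈ Θ := hΘ.mem_nhds hω
  have hC := (hT ω hω).choi_posSemidef
  obtain ⟨L, hL⟩ := exists_isSLD_matDeriv (ρ := fun t => choi (T t))
    (hnear.mono fun t ht => (hT t ht).choi_posSemidef) hd
  choose V hV hVT using fun i => hcov (U i) ⟨i, rfl⟩
  have hVV : ∀ i, (V i)ᴴ * V i = 1 := fun i => Matrix.mem_unitaryGroup_iff'.mp (hV i)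
  have hUU : ∀ i, (U i)ᴴ * U i = 1 := fun i => Matrix.mem_unitaryGroup_iff'.mp (hU.2.2.1 i)
  have hUU' : ∀ i, U i * (U i)ᴴ = 1 := fun i => Matrix.mem_unitaryGroup_iff.mp (hU.2.2.1 i)
  have hsym : ∀ i, ∀ t ∈ Θ, choiSymmetry (V i) (U i) * choi (T t) * (choiSymmetry (V i) (U i))ᴴ
      = choi (T t) := fun i t ht => choiSymmetry_conj_choi (hUU' i) (hVT i t ht)
  have hinv := fun i => hL.conj_invariant hC (choiSymmetry_conjTranspose_mul (hVV i) (hUU i))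
    (hsym i ω hω) (matDeriv_conj hd _ (hnear.mono (hsym i)))
  have hLCL : (L * choi (T ω) * L).PosSemidef := by
    have := hC.mul_mul_conjTranspose_same L
    rwa [hL.1.eq] at this
  have htr := Complex.le_def.mp hLCL.trace_nonneg
  refine ⟨L, (L * choi (T ω) * L).trace.re / d, hL, ?_, ?_⟩
  · rw [traceOut_eq_smul_one hU hVV fun i => (hinv i).2]
    congr 1
    have : (((L * choi (T ω) * L).trace.re : ℝ) : ℂ) = (L * choi (T ω) * L).trace :=
      Complex.ext (by simp) (by simpa using htr.2)
    rw [Complex.ofReal_div, this, Complex.ofReal_natCast]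
  · have h1 : (matDeriv (fun t => choi (T t)) ω).trace = (L * choi (T ω)).trace := by
      rw [hL.2, Matrix.trace_smul, Matrix.trace_add, Matrix.trace_mul_comm (choi (T ω)),
        smul_eq_mul]
      ring
    have h2 : (matDeriv (fun t => choi (T t)) ω).trace = 0 := by
      have hder : HasDerivAt (fun t => (choi (T t)).trace)
          (matDeriv (fun t => choi (T t)) ω).trace ω :=
        HasDerivAt.fun_sum fun x _ => (hd x x).hasDerivAt
      have hconst : (fun t => (choi (T t)).trace) =ᶠ[𝓝 ω] fun _ => (d : ℂ) := by
        filter_upwards [hnear] with t ht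
        rw [trace_eq_trace_traceOut, (hT t ht).traceOut_choi]
        simp
      exact hder.unique ((hasDerivAt_const ω (d : ℂ)).congr_of_eventuallyEq hconst)
    rw [traceOut_eq_smul_one hU hVV fun i => (hinv i).1, ← h1, h2]
    simp

end Channel

/-! ### Tensor powers -/

section TensorPower

variable {n n' κ : Type*} [Fintype κ]

/-- The tensor product `⨂ₖ Aₖ` of matrices on output ⊗ input, with the output factors and the input
factors collected separately. -/
def tensorPi (A : κ → Matrix (n' × n) (n' × n) ℂ) :
    Matrix ((κ → n') × (κ → n)) ((κ → n') × (κ → n)) ℂ :=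
  Matrix.of fun x y => ∏ k, A k (x.1 k, x.2 k) (y.1 k, y.2 k)

theorem choi_tensorPower [Fintype n] [DecidableEq n] (N : ℕ)
    (E : Matrix n n ℂ →ₗ[ℂ] Matrix n' n' ℂ) :
    choi (tensorPower N E) = tensorPi fun _ : Fin N => choi E := by
  ext x y
  have h : Matrix.single x.2 y.2 (1 : ℂ)
      = Matrix.of fun u v => ∏ k, Matrix.single (x.2 k) (y.2 k) (1 : ℂ) (u k) (v k) := by
    ext u v
    simp [Matrix.single_apply, Finset.prod_ite_zero, funext_iff, forall_and]
  rw [choi, Matrix.of_apply, h, tensorPower_prod]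
  rfl

theorem tensorPi_mul [DecidableEq κ] [Fintype n] [Fintype n']
    (A B : κ → Matrix (n' × n) (n' × n) ℂ) :
    tensorPi A * tensorPi B = tensorPi (A * B) := by
  ext x y
  simp only [Matrix.mul_apply, tensorPi, Matrix.of_apply, Pi.mul_apply]
  rw [Fintype.prod_sum, ← (Equiv.arrowProdEquivProdArrow κ (fun _ => n') fun _ => n).sum_comp]
  simp only [Finset.prod_mul_distrib]
  rfl

theorem tensorPi_conjTranspose (A : κ → Matrix (n' × n) (n' × n) ℂ) :
    (tensorPi A)ᴴ = tensorPi fun k => (A k)ᴴ := by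
  ext x y
  simp [tensorPi, Matrix.conjTranspose_apply]

theorem traceOut_tensorPi [DecidableEq κ] [Fintype n'] (A : κ → Matrix (n' × n) (n' × n) ℂ) :
    traceOut (tensorPi A) = Matrix.of fun s t => ∏ k, traceOut (A k) (s k) (t k) := by
  ext s t
  simp only [traceOut, tensorPi, Matrix.of_apply]
  rw [Fintype.prod_sum]

theorem posSemidef_tensorPi [DecidableEq κ] [Fintype n] [Fintype n']
    {A : κ → Matrix (n' × n) (n' × n) ℂ} (hA : ∀ k, (A k).PosSemidef) :
    (tensorPi A).PosSemidef := by
  choose B hB using fun k => (hA k).exists_eq_mul_conjTranspose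
  have : tensorPi A = tensorPi B * (tensorPi B)ᴴ := by
    rw [tensorPi_conjTranspose, tensorPi_mul]
    exact congrArg _ (funext hB)
  rw [this]
  exact Matrix.posSemidef_self_mul_conjTranspose _

theorem differentiableAt_tensorPi {X : ℝ → Matrix (n' × n) (n' × n) ℂ} {ω : ℝ}
    (hX : ∀ x y, DifferentiableAt ℝ (fun t => X t x y) ω) (x y : (κ → n') × (κ → n)) :
    DifferentiableAt ℝ (fun t => tensorPi (fun _ : κ => X t) x y) ω := by
  classical
  exact (HasDerivAt.fun_finsetProd fun k _ => (hX _ _).hasDerivAt).differentiableAt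

theorem matDeriv_tensorPi [DecidableEq κ] {X : ℝ → Matrix (n' × n) (n' × n) ℂ} {ω : ℝ}
    (hX : ∀ x y, DifferentiableAt ℝ (fun t => X t x y) ω) :
    matDeriv (fun t => tensorPi fun _ : κ => X t) ω
      = ∑ k, tensorPi (Function.update (fun _ : κ => X ω) k (matDeriv X ω)) := by
  ext x y
  rw [matDeriv_apply, Matrix.sum_apply]
  refine (HasDerivAt.fun_finsetProd fun k _ => (hX _ _).hasDerivAt).deriv.trans ?_
  refine Finset.sum_congr rfl fun k _ => ?_
  rw [tensorPi, Matrix.of_apply, ← Finset.mul_prod_erase _ _ (Finset.mem_univ k),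
    Function.update_self, smul_eq_mul, mul_comm]
  congr 1
  refine Finset.prod_congr rfl fun j hj => ?_
  rw [Function.update_of_ne (Finset.ne_of_mem_erase hj)]

theorem tensorPi_update_add [DecidableEq κ] (A : κ → Matrix (n' × n) (n' × n) ℂ) (k : κ)
    (X Y : Matrix (n' × n) (n' × n) ℂ) :
    tensorPi (Function.update A k (X + Y))
      = tensorPi (Function.update A k X) + tensorPi (Function.update A k Y) := by
  ext x y
  simp only [tensorPi, Matrix.of_apply, Matrix.add_apply,
    ← Finset.mul_prod_erase _ _ (Finset.mem_univ k), Function.update_self]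
  rw [add_mul]
  congr 2 <;>
  exact Finset.prod_congr rfl fun j hj => by
    simp only [Function.update_of_ne (Finset.ne_of_mem_erase hj)]

theorem tensorPi_update_smul [DecidableEq κ] (A : κ → Matrix (n' × n) (n' × n) ℂ) (k : κ) (c : ℂ)
    (X : Matrix (n' × n) (n' × n) ℂ) :
    tensorPi (Function.update A k (c • X)) = c • tensorPi (Function.update A k X) := by
  ext x y
  simp only [tensorPi, Matrix.of_apply, Matrix.smul_apply, smul_eq_mul,
    ← Finset.mul_prod_erase _ _ (Finset.mem_univ k), Function.update_self]
  rw [mul_assoc]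
  congr 2
  exact Finset.prod_congr rfl fun j hj => by
    simp only [Function.update_of_ne (Finset.ne_of_mem_erase hj)]

/-- The sum `∑ₖ 𝟙 ⊗ ⋯ ⊗ L ⊗ ⋯ ⊗ 𝟙`. -/
def tensorSum (κ : Type*) [Fintype κ] [DecidableEq κ] [DecidableEq n] [DecidableEq n']
    (L : Matrix (n' × n) (n' × n) ℂ) :
    Matrix ((κ → n') × (κ → n)) ((κ → n') × (κ → n)) ℂ :=
  ∑ k, tensorPi (Function.update (1 : κ → Matrix (n' × n) (n' × n) ℂ) k L)

variable [DecidableEq κ] [Fintype n] [DecidableEq n] [Fintype n'] [DecidableEq n']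

theorem const_mul_update_one {ι M : Type*} [DecidableEq ι] [Monoid M] (C L : M) (k : ι) :
    (fun _ : ι => C) * Function.update (1 : ι → M) k L =
      Function.update (fun _ => C) k (C * L) := by
  ext1 j
  rcases eq_or_ne j k with rfl | h <;> simp [*]

theorem update_one_mul_const {ι M : Type*} [DecidableEq ι] [Monoid M] (C L : M) (k : ι) :
    Function.update (1 : ι → M) k L * (fun _ : ι => C) = Function.update (fun _ => C) k (L * C) := by
  ext1 j
  rcases eq_or_ne j k with rfl | h <;> simp [*]

theorem isSLD_tensorSum {X : ℝ → Matrix (n' × n) (n' × n) ℂ} {ω : ℝ}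
    (hX : ∀ x y, DifferentiableAt ℝ (fun t => X t x y) ω)
    {L : Matrix (n' × n) (n' × n) ℂ} (hL : IsSLD (X ω) (matDeriv X ω) L) :
    IsSLD (tensorPi fun _ : κ => X ω) (matDeriv (fun t => tensorPi fun _ : κ => X t) ω)
      (tensorSum κ L) := by
  constructor
  · rw [Matrix.IsHermitian, tensorSum, Matrix.conjTranspose_sum]
    refine Finset.sum_congr rfl fun k _ => ?_
    rw [tensorPi_conjTranspose]
    congr 1
    ext1 j
    rcases eq_or_ne j k with rfl | h
    · simpa using hL.1.eq
    · simp [h]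
  · rw [matDeriv_tensorPi hX, tensorSum, Finset.mul_sum, Finset.sum_mul, ← Finset.sum_add_distrib,
      Finset.smul_sum]
    refine Finset.sum_congr rfl fun k _ => ?_
    rw [tensorPi_mul, tensorPi_mul, const_mul_update_one, update_one_mul_const,
      ← tensorPi_update_add, ← tensorPi_update_smul, ← hL.2]

/-- In the expansion of `(∑ₖ Lₖ) C^{⊗κ} (∑ₗ Lₗ)` the terms with `k ≠ l` have a factor
`Tr_out (L C)`, so only the diagonal terms survive. -/
theorem traceOut_tensorSum {C L : Matrix (n' × n) (n' × n) ℂ} {c : ℂ}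
    (h1 : traceOut C = 1) (h0 : traceOut (L * C) = 0) (hc : traceOut (L * C * L) = c • 1) :
    traceOut (tensorSum κ L * (tensorPi fun _ : κ => C) * tensorSum κ L)
      = (Fintype.card κ * c) • 1 := by
  have hsum : ∀ f : κ → Matrix ((κ → n') × (κ → n)) ((κ → n') × (κ → n)) ℂ,
      traceOut (∑ k, f k) = ∑ k, traceOut (f k) := by
    intro f
    ext s t
    simp only [traceOut, Matrix.of_apply, Matrix.sum_apply]
    rw [Finset.sum_comm]
  let I : κ → Matrix (n' × n) (n' × n) ℂ := 1
  have hterm : ∀ k l, traceOut (tensorPi (Function.update I k L) * (tensorPi fun _ : κ => C) *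
      tensorPi (Function.update I l L)) = if k = l then c • 1 else 0 := by
    intro k l
    rw [tensorPi_mul, tensorPi_mul, update_one_mul_const, traceOut_tensorPi]
    ext s t
    rw [Matrix.of_apply, ← Finset.mul_prod_erase _ _ (Finset.mem_univ k)]
    rcases eq_or_ne k l with rfl | hkl
    · have : ∀ j ∈ Finset.univ.erase k, traceOut ((Function.update (fun _ : κ => C) k (L * C) *
          Function.update I k L) j) (s j) (t j) = if s j = t j then 1 else 0 := by
        intro j hj
        simp [I, Function.update_of_ne (Finset.ne_of_mem_erase hj), h1, Matrix.one_apply]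
      rw [Finset.prod_congr rfl this]
      simp only [Pi.mul_apply, Function.update_self, hc, if_true, Matrix.smul_apply,
        Matrix.one_apply, smul_eq_mul]
      rw [mul_assoc, Finset.mul_prod_erase Finset.univ
        (fun j => if s j = t j then (1 : ℂ) else 0) (Finset.mem_univ k)]
      simp [Finset.prod_ite_zero, funext_iff]
    · simp [I, hkl, h0]
  simp only [tensorSum, Finset.sum_mul, Finset.mul_sum, hsum]
  change ∑ l, ∑ k, traceOut (tensorPi (Function.update I k L) * (tensorPi fun _ : κ => C) *
    tensorPi (Function.update I l L)) = _
  simp only [hterm]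
  simp [← Nat.cast_smul_eq_nsmul ℂ, smul_smul]

end TensorPower

end ChannelQFI

/-! ### Covariant families of channels -/

theorem mainTheorem4 {d d' n : ℕ} (hd : 0 < d)
    (p : Fin n → ℝ) (U : Fin n → Matrix (Fin d) (Fin d) ℂ)
    (hU : IsUnitaryOneDesign p U)
    (Θ : Set ℝ) (hΘ : IsOpen Θ)
    (T : ℝ → Matrix (Fin d) (Fin d) ℂ →ₗ[ℂ] Matrix (Fin d') (Fin d') ℂ)
    (hT : ∀ ω ∈ Θ, IsQuantumChannel (T ω))
    (hcov : IsJointlyCovariant (Set.range U) Θ T)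
    (ω : ℝ) (hω : ω ∈ Θ)
    (hdiff : ∀ ρ i j, DifferentiableAt ℝ (fun t => T t ρ i j) ω) :
    IsOptimalInput T ω (maxEntangled (Fin d)) ∧
    (∀ N : ℕ, IsOptimalInput (fun t => tensorPower N (T t)) ω
      (maxEntangled (Fin N → Fin d))) ∧
    channelQFI T ω ≠ ∞ ∧
    (∀ N : ℕ, channelQFIPow T N ω = N * channelQFI T ω) ∧
    Tendsto (fun N : ℕ => channelQFIPow T N ω / N) atTop (𝓝 (channelQFI T ω)) := by
  have : Nonempty (Fin d) := ⟨⟨0, hd⟩⟩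
  have hdC : ∀ x y, DifferentiableAt ℝ (fun t => choi (T t) x y) ω := fun x y => hdiff _ _ _
  obtain ⟨L, c, hL, hc, h0⟩ :=
    exists_isSLD_choi_of_isJointlyCovariant p hU hΘ hT hcov hω hdC
  have hC := (hT ω hω).choi_posSemidef
  obtain ⟨hopt, hval⟩ := isOptimalInput_maxEntangled hC hdC hL hc
  have hN : ∀ N : ℕ, IsOptimalInput (fun t => tensorPower N (T t)) ω
      (maxEntangled (Fin N → Fin d)) ∧ channelQFIPow T N ω = ENNReal.ofReal (N * c) := by
    intro N
    refine isOptimalInput_maxEntangled (L := tensorSum (Fin N) L) ?_ ?_ ?_ ?_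
    · rw [choi_tensorPower]
      exact posSemidef_tensorPi fun _ => hC
    · simp_rw [choi_tensorPower]
      exact differentiableAt_tensorPi hdC
    · simp_rw [choi_tensorPower]
      exact isSLD_tensorSum hdC hL
    · rw [choi_tensorPower, traceOut_tensorSum (hT ω hω).traceOut_choi h0 hc]
      simp
  have hmul : ∀ N : ℕ, channelQFIPow T N ω = N * channelQFI T ω := by
    intro N
    rw [(hN N).2, hval, ENNReal.ofReal_mul (Nat.cast_nonneg N), ENNReal.ofReal_natCast]
  refine ⟨hopt, fun N => (hN N).1, hval ▸ ENNReal.ofReal_ne_top, hmul, ?_⟩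
  -- the quotient at `N = 0` is the junk value `0 / 0`, irrelevant for the limit
  refine tendsto_const_nhds.congr' ?_
  filter_upwards [eventually_gt_atTop 0] with N hNpos
  rw [hmul, mul_comm, ENNReal.mul_div_cancel_right (by exact_mod_cast hNpos.ne')
    (ENNReal.natCast_ne_top N)]
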